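/- Let $V$ be a finite set and let $G, G'$ be directed acyclic graphs with vertex set $V$. Write $\mathrm{pa}_G(v)=\{u : u\to v \text{ in } G\}$ for the set of parents of $v$; a set $A\subseteq V$ is ancestral in $G$ if $\mathrm{pa}_G(v)\subseteq A$ for all $v\in A$, and $\mathrm{an}_G(B)$ denotes the smallest ancestral set containing $B$. The moral graph of a directed graph is the undirected graph obtained by joining any two distinct vertices that have a common child and then forgetting the directions of the edges. The semi-graphoid of $G$ is the set $\mathcal M(G)$ of all triples $\langle A,B\mid C\rangle$ of (not necessarily disjoint) subsets of $V$ such that $A$ and $B$ are separated by $C$ in the moral graph of the subgraph of $G$ induced on $\mathrm{an}_G(A\cup B\cup C)$, that is, such that every path in that moral graph (including paths of length zero) from an element of $A$ to an element of $B$ contains an element of $C$. The graphs $G$ and $G'$ are Markov equivalent if $\mathcal M(G)=\mathcal M(G')$. The d-clique vector of $G$ is $$t(G)=\sum_{v\in V}\bigl[\delta(\{v\}\cup \mathrm{pa}_G(v))-\delta(\mathrm{pa}_G(v))\bigr]+\delta(\varnothing)\in\mathbb Z^{2^V},\qquad \delta(A)=(\mathbf 1_{S=A})_{S\subseteq V}.$$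 Then $G$ and $G'$ are Markov equivalent if and only if $t(G)=t(G')$. -/

import Mathlib

namespace DagMarkov

universe u

variable {V : Type u}

/-- A directed graph is acyclic if its vertex set has a (strict) well-ordering `r` that is
compatible with it: `r u v` for every edge `u → v`. -/
def IsAcyclic (G : Digraph V) : Prop :=
  ∃ r : V → V → Prop, IsWellOrder V r ∧ ∀ u v, G.Adj u v → r u v

/-- The set of parents of `v`. -/
def parents (G : Digraph V) (v : V) : Set V := {u | G.Adj u v}

/-- The subgraph induced on the vertex set `S`. -/
def induced (G : Digraph V) (S : Set V) : Digraph S where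
  Adj u v := G.Adj u v

/-- A set of vertices is ancestral if it contains the parents of each of its elements. -/
def IsAncestral (G : Digraph V) (A : Set V) : Prop :=
  ∀ v ∈ A, parents G v ⊆ A

/-- The smallest ancestral set that contains `B`. -/
def ancestralClosure (G : Digraph V) (B : Set V) : Set V :=
  ⋂₀ {A | IsAncestral G A ∧ B ⊆ A}

/-- The moral graph: the skeleton, with an edge added between any two distinct vertices that have
a common child. -/
def moralGraph (G : Digraph V) : SimpleGraph V :=
  SimpleGraph.fromRel fun u v => G.Adj u v ∨ ∃ w, G.Adj u w ∧ G.Adj v w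

/-- `A` and `B` are separated by `C` in the undirected graph `H` if every path (any walk, possibly
of length zero) from an element of `A` to an element of `B` contains an element of `C`. -/
def Separated (H : SimpleGraph V) (A B C : Set V) : Prop :=
  ∀ a ∈ A, ∀ b ∈ B, ∀ p : H.Walk a b, ∃ c ∈ p.support, c ∈ C

/-- The semi-graphoid of a directed acyclic graph: the triples `(A, B, C)`, standing for
`⟨A, B | C⟩`, such that `A` and `B` are separated by `C` in the moral graph of the subgraph induced
on the smallest ancestral set containing `A ∪ B ∪ C`. -/
def semigraphoid (G : Digraph V) : Set (Set V × Set V × Set V) :=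
  {T | Separated (moralGraph (induced G (ancestralClosure G (T.1 ∪ T.2.1 ∪ T.2.2))))
    (Subtype.val ⁻¹' T.1) (Subtype.val ⁻¹' T.2.1) (Subtype.val ⁻¹' T.2.2)}

/-- Markov equivalence: equality of semi-graphoids. -/
def MarkovEquiv (G G' : Digraph V) : Prop := semigraphoid G = semigraphoid G'

open Classical in
/-- The unit vector of `ℤ^(2^V)` at the coordinate `A`. -/
noncomputable def delta (A : Set V) : Set V → ℤ := fun S => if S = A then 1 else 0

/-- The d-clique vector. -/
noncomputable def dCliqueVector [Fintype V] (G : Digraph V) : Set V → ℤ :=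
  (∑ v : V, (delta ({v} ∪ parents G v) - delta (parents G v))) + delta ∅

end DagMarkov

/-!
Call `S` a family of `G` if it consists of a vertex, its head, and some parents of the head. The
semi-graphoid and the d-clique vector each determine the families and are determined by them.

* The sum of `t(G)` over the supersets of a nonempty `S` is `1` if `S` is a family and `0`
  otherwise, and a function on the subsets of `V` can be recovered from its sums over supersets.
* A nonempty `S` is a family iff no two of its vertices can be separated by a set containing the
  rest of `S`.
* Two vertices are adjacent in the moral graph on `E` iff a family inside `E` contains both. So for
  graphs with the same families only the ancestral closures `E` (for `G`) and `F` (for `G'`) of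
  `A ∪ B ∪ C` differ. A sink `v` of `E \ F` in `G'` is a sink of `E` in `G'`, so together with its
  neighbours it forms a family of `G'`, hence of `G`. As `v ∉ A ∪ B ∪ C`, it is not a sink of `E` in
  `G`, so the head of that family in `G` is a child of `v` and makes the neighbours of `v` pairwise
  adjacent without it. Thus `E` can be shrunk to `E ∩ F` one vertex at a time without creating
  separations.
-/

namespace DagMarkov

section Separation

variable {V : Type*} {H H' : SimpleGraph V} {A B C : Set V}

theorem Separated.anti (hle : H ≤ H') (hsep : Separated H' A B C) : Separated H A B C := by
  intro a ha b hb p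
  simpa only [SimpleGraph.Walk.support_mapLe_eq_support] using hsep a ha b hb (p.mapLe hle)

theorem not_separated_of_adj {a b : V} (hab : H.Adj a b) (ha : a ∉ C) (hb : b ∉ C) :
    ¬ Separated H {a} {b} C := by
  intro hsep
  obtain ⟨c, hc, hcC⟩ := hsep a rfl b rfl hab.toWalk
  obtain rfl | rfl : c = a ∨ c = b := by simpa using hc
  exacts [ha hcC, hb hcC]

theorem separated_of_not_adj {a b : V} (hne : a ≠ b) (hab : ¬ H.Adj a b)
    (hC : ∀ x, H.Adj a x → x = b ∨ x ∈ C) : Separated H {a} {b} C := by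
  rintro _ rfl _ rfl p
  cases p with
  | nil => exact absurd rfl hne
  | cons hax q =>
    refine ⟨_, ?_, (hC _ hax).resolve_left fun hxb => hab (hxb ▸ hax)⟩
    simp

theorem separated_induce_iff {E : Set V} (hE : ∀ ⦃x y⦄, H.Adj x y → y ∈ E) (hA : A ⊆ E) :
    Separated (H.induce E) (Subtype.val ⁻¹' A) (Subtype.val ⁻¹' B) (Subtype.val ⁻¹' C) ↔
      Separated H A B C := by
  have support_subset : ∀ {a b : V} (p : H.Walk a b), a ∈ E → ∀ x ∈ p.support, x ∈ E := by
    intro a b p ha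
    induction p with
    | nil => simpa using ha
    | cons h q ih => simpa using ⟨ha, ih (hE h)⟩
  constructor
  · intro hsep a ha b hb p
    have hp := support_subset p (hA ha)
    obtain ⟨c, hc, hcC⟩ := hsep ⟨a, hA ha⟩ ha ⟨b, hp b p.end_mem_support⟩ hb (p.induce E hp)
    exact ⟨c, by simpa using hc, hcC⟩
  · intro hsep a ha b hb p
    let inclusion : H.induce E →g H := (SimpleGraph.Embedding.induce E).toHom
    obtain ⟨c, hc, hcC⟩ := hsep (inclusion a) ha (inclusion b) hb (p.map inclusion)
    rw [SimpleGraph.Walk.support_map, List.mem_map] at hc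
    obtain ⟨c, hc, rfl⟩ := hc
    exact ⟨c, hc, hcC⟩

theorem exists_walk_support_subset_of_bypass {v : V}
    (hadj : ∀ ⦃x y⦄, x ≠ v → y ≠ v → H.Adj x y → H'.Adj x y)
    (hnbr : ∀ ⦃x y⦄, H.Adj v x → H.Adj v y → x ≠ y → H'.Adj x y) :
    ∀ {a b : V} (p : H.Walk a b), a ≠ v → b ≠ v → ∃ q : H'.Walk a b, q.support ⊆ p.support
  | _, _, .nil, _, _ => ⟨.nil, by simp⟩
  | a, b, .cons (v := x) hax p, ha, hb => by
    by_cases hx : x = v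
    · subst hx
      cases p with
      | nil => exact absurd rfl hb
      | @cons _ y _ hxy p =>
        obtain ⟨q, hq⟩ := exists_walk_support_subset_of_bypass hadj hnbr p hxy.ne' hb
        by_cases hay : a = y
        · subst hay
          exact ⟨q, fun z hz => by simp [hq hz]⟩
        · exact ⟨.cons (hnbr hax.symm hxy hay) q, by grind [SimpleGraph.Walk.support_cons]⟩
    · obtain ⟨q, hq⟩ := exists_walk_support_subset_of_bypass hadj hnbr p hx hb
      exact ⟨.cons (hadj ha hx hax) q, by grind [SimpleGraph.Walk.support_cons]⟩
  termination_by _ _ p => p.length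

theorem Separated.of_bypass {v : V} (hadj : ∀ ⦃x y⦄, x ≠ v → y ≠ v → H.Adj x y → H'.Adj x y)
    (hnbr : ∀ ⦃x y⦄, H.Adj v x → H.Adj v y → x ≠ y → H'.Adj x y) (hA : v ∉ A) (hB : v ∉ B)
    (hsep : Separated H' A B C) : Separated H A B C := by
  intro a ha b hb p
  obtain ⟨q, hq⟩ := exists_walk_support_subset_of_bypass hadj hnbr p
    (ne_of_mem_of_not_mem ha hA) (ne_of_mem_of_not_mem hb hB)
  obtain ⟨c, hc, hcC⟩ := hsep a ha b hb q
  exact ⟨c, hq hc, hcC⟩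

end Separation

variable {V : Type*} {G G' : Digraph V}

theorem IsAcyclic.irrefl (hG : IsAcyclic G) (v : V) : ¬ G.Adj v v := by
  obtain ⟨r, _, hr⟩ := hG
  exact fun h => irrefl_of r v (hr v v h)

theorem IsAcyclic.asymm (hG : IsAcyclic G) {u v : V} (huv : G.Adj u v) : ¬ G.Adj v u := by
  obtain ⟨r, _, hr⟩ := hG
  exact fun hvu => asymm_of r (hr u v huv) (hr v u hvu)

theorem subset_ancestralClosure (G : Digraph V) (B : Set V) : B ⊆ ancestralClosure G B :=
  Set.subset_sInter fun _ hA => hA.2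

theorem isAncestral_ancestralClosure (G : Digraph V) (B : Set V) :
    IsAncestral G (ancestralClosure G B) :=
  fun _ hv _ hu A hA => hA.1 _ (hv A hA) hu

theorem ancestralClosure_subset {A B : Set V} (hA : IsAncestral G A) (hB : B ⊆ A) :
    ancestralClosure G B ⊆ A :=
  Set.sInter_subset_of_mem ⟨hA, hB⟩

theorem IsAncestral.ancestralClosure_eq {A : Set V} (hA : IsAncestral G A) :
    ancestralClosure G A = A :=
  (ancestralClosure_subset hA subset_rfl).antisymm (subset_ancestralClosure G A)

/-- The sinks of the subgraph induced on `E`. -/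
def sinks (G : Digraph V) (E : Set V) : Set V := {v ∈ E | ∀ w ∈ E, ¬ G.Adj v w}

theorem IsAcyclic.sinks_nonempty (hG : IsAcyclic G) {E : Set V} (hfin : E.Finite)
    (hne : E.Nonempty) : (sinks G E).Nonempty := by
  classical
  obtain ⟨r, _, hr⟩ := hG
  let _ := linearOrderOfSTO r
  obtain ⟨v, hv, hmax⟩ := E.exists_max_image id hfin hne
  exact ⟨v, hv, fun w hw hvw => (hmax w hw).not_gt (hr v w hvw)⟩

theorem sinks_ancestralClosure_subset (G : Digraph V) (K : Set V) :
    sinks G (ancestralClosure G K) ⊆ K := by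
  rintro v ⟨hv, hsink⟩
  by_contra hvK
  have hanc : IsAncestral G (ancestralClosure G K \ {v}) := fun x hx y hyx =>
    ⟨isAncestral_ancestralClosure G K x hx.1 hyx, fun hyv => hsink x hx.1 (hyv ▸ hyx)⟩
  exact (ancestralClosure_subset hanc
    (Set.subset_sdiff_singleton (subset_ancestralClosure G K) hvK) hv).2 rfl

/-- `S` is a family with head `v` if it consists of `v` and some of the parents of `v`. -/
def IsFamilyWithHead (G : Digraph V) (S : Set V) (v : V) : Prop :=
  v ∈ S ∧ S ⊆ {v} ∪ parents G v

/-- A family is a vertex together with some of its parents. Families are the link between the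
semi-graphoid and the d-clique vector, each of which encodes exactly the families. -/
def IsFamily (G : Digraph V) (S : Set V) : Prop :=
  ∃ v, IsFamilyWithHead G S v

theorem IsFamily.nonempty {S : Set V} (hS : IsFamily G S) : S.Nonempty :=
  hS.imp fun _ h => h.1

theorem isFamily_pair {u v : V} (huv : G.Adj u v) : IsFamily G {u, v} :=
  ⟨v, by simp, by grind [parents]⟩

theorem IsFamilyWithHead.head_unique (hG : IsAcyclic G) {S : Set V} {u v : V}
    (hu : IsFamilyWithHead G S u) (hv : IsFamilyWithHead G S v) : u = v := by
  by_contra hne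
  exact hG.asymm ((hv.2 hu.1).resolve_left hne) ((hu.2 hv.1).resolve_left (Ne.symm hne))

/-- The moral graph of the subgraph induced on `E`, as a graph on all of `V` in which the vertices
outside `E` are isolated. Adjacency is phrased through families so that the graph manifestly
depends on `G` only through them; see `induce_moralGraphOn`. -/
def moralGraphOn (G : Digraph V) (E : Set V) : SimpleGraph V where
  Adj u v := u ≠ v ∧ ∃ S ⊆ E, IsFamily G S ∧ u ∈ S ∧ v ∈ S
  symm := ⟨fun _ _ ⟨hne, S, hSE, hS, hu, hv⟩ => ⟨hne.symm, S, hSE, hS, hv, hu⟩⟩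
  loopless := ⟨fun _ h => h.1 rfl⟩

theorem moralGraphOn_congr (h : IsFamily G = IsFamily G') : moralGraphOn G = moralGraphOn G' := by
  ext E u v
  simp only [moralGraphOn, h]

theorem moralGraphOn_mono {E E' : Set V} (hE : E ⊆ E') : moralGraphOn G E ≤ moralGraphOn G E' :=
  fun _ _ ⟨hne, S, hSE, hS⟩ => ⟨hne, S, hSE.trans hE, hS⟩

theorem mem_of_moralGraphOn_adj {E : Set V} {u v : V} (h : (moralGraphOn G E).Adj u v) : v ∈ E :=
  let ⟨_, _, hSE, _, _, hv⟩ := h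
  hSE hv

theorem moralGraphOn_adj_of_adj (hG : IsAcyclic G) {E : Set V} {u v : V} (hu : u ∈ E) (hv : v ∈ E)
    (huv : G.Adj u v) : (moralGraphOn G E).Adj u v :=
  ⟨fun h => hG.irrefl v (h ▸ huv), {u, v}, Set.pair_subset hu hv, isFamily_pair huv, by simp,
    by simp⟩

theorem induce_moralGraphOn (G : Digraph V) (E : Set V) :
    (moralGraphOn G E).induce E = moralGraph (induced G E) := by
  ext ⟨u, hu⟩ ⟨v, hv⟩
  simp only [SimpleGraph.comap_adj, Function.Embedding.subtype_apply, moralGraph,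
    SimpleGraph.fromRel_adj, induced, Subtype.exists, ne_eq, Subtype.mk.injEq]
  refine and_congr_right fun hne => ⟨?_, ?_⟩
  · rintro ⟨S, hSE, ⟨w, hw, hS⟩, huS, hvS⟩
    rcases hS huS with rfl | huw <;> rcases hS hvS with rfl | hvw
    · exact absurd rfl hne
    · exact .inr (.inl hvw)
    · exact .inl (.inl huw)
    · exact .inl (.inr ⟨w, hSE hw, huw, hvw⟩)
  · have common_child : ∀ w ∈ E, G.Adj u w → G.Adj v w →
        ∃ S ⊆ E, IsFamily G S ∧ u ∈ S ∧ v ∈ S := fun w hw huw hvw =>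
      ⟨{u, v, w}, by grind, ⟨w, by simp, by grind [parents]⟩, by simp, by simp⟩
    rintro ((huv | ⟨w, hw, huw, hvw⟩) | (hvu | ⟨w, hw, hvw, huw⟩))
    · exact ⟨{u, v}, Set.pair_subset hu hv, isFamily_pair huv, by simp, by simp⟩
    · exact common_child w hw huw hvw
    · exact ⟨{v, u}, Set.pair_subset hv hu, isFamily_pair hvu, by simp, by simp⟩
    · exact common_child w hw huw hvw

theorem mem_semigraphoid_iff {A B C : Set V} :
    (A, B, C) ∈ semigraphoid G ↔
      Separated (moralGraphOn G (ancestralClosure G (A ∪ B ∪ C))) A B C := by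
  have hA : A ⊆ ancestralClosure G (A ∪ B ∪ C) :=
    (Set.subset_union_left.trans Set.subset_union_left).trans (subset_ancestralClosure G _)
  rw [← separated_induce_iff (fun _ _ => mem_of_moralGraphOn_adj) hA, induce_moralGraphOn]
  rfl

theorem adj_of_mem_sinks {E : Set V} {u v : V} (hv : v ∈ sinks G E)
    (hvu : (moralGraphOn G E).Adj v u) : G.Adj u v := by
  obtain ⟨hne, S, hSE, ⟨w, hw, hS⟩, hvS, huS⟩ := hvu
  obtain rfl : v = w := (hS hvS).resolve_right (hv.2 w (hSE hw))
  exact (hS huS).resolve_left hne.symm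

/-- For `v ∈ E`: a child `w` of `v` in `E` such that all neighbours of `v` in the moral graph on `E`
are equal to `w` or parents of `w`. -/
structure IsDominatingChild (G : Digraph V) (E : Set V) (v w : V) : Prop where
  mem : w ∈ E
  adj : G.Adj v w
  neighbor_mem : ∀ ⦃x⦄, (moralGraphOn G E).Adj v x → x ∈ {w} ∪ parents G w

theorem exists_isDominatingChild (hG : IsAcyclic G) (h : IsFamily G = IsFamily G') {E : Set V}
    {v : V} (hsink' : v ∈ sinks G' E) (hsink : v ∉ sinks G E) :
    ∃ w, IsDominatingChild G E v w := by
  obtain ⟨c, hc, hvc⟩ : ∃ c ∈ E, G.Adj v c := by simpa [sinks, hsink'.1] using hsink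
  let N : Set V := {v} ∪ {x | (moralGraphOn G E).Adj v x}
  have hfamily : IsFamily G N := by
    rw [h]
    refine ⟨v, .inl rfl, Set.union_subset_union_right _ fun x hx => adj_of_mem_sinks hsink' ?_⟩
    rwa [← moralGraphOn_congr h]
  obtain ⟨w, hwN, hNw⟩ := hfamily
  have hcN : c ∈ N := .inr (moralGraphOn_adj_of_adj hG hsink'.1 hc hvc)
  have hwv : w ≠ v := by
    rintro rfl
    rcases hNw hcN with rfl | hcw
    exacts [hG.irrefl _ hvc, hG.asymm hvc hcw]
  exact ⟨w, mem_of_moralGraphOn_adj (hwN.resolve_left hwv),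
    (hNw (.inl rfl)).resolve_left hwv.symm, fun x hx => hNw (.inr hx)⟩

namespace IsDominatingChild

variable {E : Set V} {v w : V}

theorem adj_of_neighbors (hG : IsAcyclic G) (hw : IsDominatingChild G E v w) {x y : V}
    (hx : (moralGraphOn G E).Adj v x) (hy : (moralGraphOn G E).Adj v y) (hne : x ≠ y) :
    (moralGraphOn G (E \ {v})).Adj x y := by
  have hwv : w ≠ v := fun h => hG.irrefl v (h ▸ hw.adj)
  refine ⟨hne, {x, y, w}, ?_, ⟨w, by simp, ?_⟩, by simp, by simp⟩
  · rintro z (rfl | rfl | rfl)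
    exacts [⟨mem_of_moralGraphOn_adj hx, hx.ne'⟩, ⟨mem_of_moralGraphOn_adj hy, hy.ne'⟩,
      ⟨hw.mem, hwv⟩]
  · rintro z (rfl | rfl | rfl)
    exacts [hw.neighbor_mem hx, hw.neighbor_mem hy, .inl rfl]

theorem adj_sdiff_singleton (hG : IsAcyclic G) (hw : IsDominatingChild G E v w) {x y : V}
    (hxv : x ≠ v) (hyv : y ≠ v) (hxy : (moralGraphOn G E).Adj x y) :
    (moralGraphOn G (E \ {v})).Adj x y := by
  obtain ⟨hne, S, hSE, hS, hxS, hyS⟩ := hxy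
  by_cases hvS : v ∈ S
  · exact hw.adj_of_neighbors hG ⟨hxv.symm, S, hSE, hS, hvS, hxS⟩ ⟨hyv.symm, S, hSE, hS, hvS, hyS⟩
      hne
  · exact ⟨hne, S, Set.subset_sdiff_singleton hSE hvS, hS, hxS, hyS⟩

theorem separated (hG : IsAcyclic G) (hw : IsDominatingChild G E v w) {A B C : Set V}
    (hA : v ∉ A) (hB : v ∉ B) (hsep : Separated (moralGraphOn G (E \ {v})) A B C) :
    Separated (moralGraphOn G E) A B C :=
  hsep.of_bypass (fun _ _ => hw.adj_sdiff_singleton hG) (fun _ _ => hw.adj_of_neighbors hG) hA hB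

theorem sinks_sdiff_singleton_subset (hG : IsAcyclic G) (hw : IsDominatingChild G E v w) :
    sinks G (E \ {v}) ⊆ sinks G E := by
  rintro u ⟨⟨huE, -⟩, hsink⟩
  refine ⟨huE, fun z hzE huz => ?_⟩
  by_cases hzv : z = v
  · subst hzv
    have hwz : w ≠ z := fun h => hG.irrefl z (h ▸ hw.adj)
    rcases hw.neighbor_mem (moralGraphOn_adj_of_adj hG huE hzE huz).symm with rfl | huw
    exacts [hG.asymm huz hw.adj, hsink w ⟨hw.mem, hwz⟩ huw]
  · exact hsink z ⟨hzE, hzv⟩ huz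

end IsDominatingChild

theorem IsAncestral.sinks_sdiff_subset {F : Set V} (hF : IsAncestral G F) (E : Set V) :
    sinks G (E \ F) ⊆ sinks G E :=
  fun _ ⟨⟨hvE, hvF⟩, hsink⟩ =>
    ⟨hvE, fun w hw hvw => hsink w ⟨hw, fun hwF => hvF (hF w hwF hvw)⟩ hvw⟩

theorem separated_moralGraphOn_of_inter [Finite V] (hG : IsAcyclic G) (hG' : IsAcyclic G')
    (h : IsFamily G = IsFamily G') {E F A B C : Set V} (hF : IsAncestral G' F)
    (hsinks : sinks G E ⊆ F) (hA : A ⊆ F) (hB : B ⊆ F)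
    (hsep : Separated (moralGraphOn G (E ∩ F)) A B C) : Separated (moralGraphOn G E) A B C := by
  induction E using WellFoundedLT.induction with
  | ind E ih =>
    rcases (E \ F).eq_empty_or_nonempty with hEF | hEF
    · rwa [Set.inter_eq_left.2 (Set.sdiff_eq_empty.1 hEF)] at hsep
    obtain ⟨v, hv⟩ := hG'.sinks_nonempty (E \ F).toFinite hEF
    obtain ⟨hvE, hvF⟩ : v ∈ E \ F := hv.1
    obtain ⟨w, hw⟩ := exists_isDominatingChild hG h (hF.sinks_sdiff_subset E hv)
      fun hvG => hvF (hsinks hvG)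
    refine hw.separated hG (fun hvA => hvF (hA hvA)) (fun hvB => hvF (hB hvB)) ?_
    exact ih (E \ {v}) (Set.sdiff_singleton_ssubset.2 hvE)
      ((hw.sinks_sdiff_singleton_subset hG).trans hsinks)
      (hsep.anti (moralGraphOn_mono (Set.inter_subset_inter_left F Set.sdiff_subset)))

theorem semigraphoid_subset_of_isFamily_eq [Finite V] (hG : IsAcyclic G) (hG' : IsAcyclic G')
    (h : IsFamily G = IsFamily G') : semigraphoid G' ⊆ semigraphoid G := by
  rintro ⟨A, B, C⟩ hsep
  rw [mem_semigraphoid_iff] at hsep ⊢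
  let F := ancestralClosure G' (A ∪ B ∪ C)
  have hABC : A ∪ B ∪ C ⊆ F := subset_ancestralClosure G' _
  have hAB : A ∪ B ⊆ F := Set.subset_union_left.trans hABC
  refine separated_moralGraphOn_of_inter hG hG' h (isAncestral_ancestralClosure G' _)
    ((sinks_ancestralClosure_subset G _).trans hABC) (Set.subset_union_left.trans hAB)
    (Set.subset_union_right.trans hAB) (Separated.anti ?_ hsep)
  rw [moralGraphOn_congr h]
  exact moralGraphOn_mono Set.inter_subset_right

theorem IsFamily.notMem_semigraphoid {S C : Set V} (hS : IsFamily G S) {a b : V} (ha : a ∈ S)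
    (hb : b ∈ S) (hab : a ≠ b) (hSC : S \ {a, b} ⊆ C) (haC : a ∉ C) (hbC : b ∉ C) :
    ({a}, {b}, C) ∉ semigraphoid G := by
  rw [mem_semigraphoid_iff]
  have hSE : S ⊆ {a} ∪ {b} ∪ C := by grind
  exact not_separated_of_adj
    ⟨hab, S, hSE.trans (subset_ancestralClosure G _), hS, ha, hb⟩ haC hbC

theorem adj_of_notMem_semigraphoid {E : Set V} (hE : IsAncestral G E) {u v : V} (hu : u ∈ E)
    (hv : v ∈ sinks G E) (huv : u ≠ v) (hmem : ({u}, {v}, E \ {u, v}) ∉ semigraphoid G) :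
    G.Adj u v := by
  have hunion : {u} ∪ {v} ∪ E \ {u, v} = E := by grind [sinks]
  rw [mem_semigraphoid_iff, hunion, hE.ancestralClosure_eq] at hmem
  by_contra hadj
  refine hmem (separated_of_not_adj huv (fun h => hadj (adj_of_mem_sinks hv h.symm)) ?_)
  intro x hux
  have hxE := mem_of_moralGraphOn_adj hux
  have hxu := hux.ne'
  grind

theorem isFamily_iff_notMem_semigraphoid [Finite V] (hG : IsAcyclic G) {S : Set V} :
    IsFamily G S ↔ S.Nonempty ∧ ∀ a ∈ S, ∀ b ∈ S, a ≠ b → ∀ C, S \ {a, b} ⊆ C →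
      a ∉ C → b ∉ C → ({a}, {b}, C) ∉ semigraphoid G := by
  constructor
  · exact fun hS => ⟨hS.nonempty, fun a ha b hb hab C => hS.notMem_semigraphoid ha hb hab⟩
  · rintro ⟨hne, hinsep⟩
    let E := ancestralClosure G S
    have hSE : S ⊆ E := subset_ancestralClosure G S
    obtain ⟨v, hv⟩ := hG.sinks_nonempty E.toFinite (hne.mono hSE)
    have hvS : v ∈ S := sinks_ancestralClosure_subset G S hv
    refine ⟨v, hvS, fun u hu => or_iff_not_imp_left.2 fun huv => ?_⟩
    exact adj_of_notMem_semigraphoid (isAncestral_ancestralClosure G S) (hSE hu) hv huv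
      (hinsep u hu v hvS huv _ (Set.sdiff_subset_sdiff_left hSE) (by simp) (by simp))

theorem markovEquiv_iff_isFamily_eq [Finite V] (hG : IsAcyclic G) (hG' : IsAcyclic G') :
    MarkovEquiv G G' ↔ IsFamily G = IsFamily G' := by
  constructor
  · intro h
    funext S
    rw [isFamily_iff_notMem_semigraphoid hG, isFamily_iff_notMem_semigraphoid hG',
      show semigraphoid G = semigraphoid G' from h]
  · intro h
    exact (semigraphoid_subset_of_isFamily_eq hG' hG h.symm).antisymm
      (semigraphoid_subset_of_isFamily_eq hG hG' h)

section UpperSum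

variable {α M : Type*} [Fintype α]

open Classical in
/-- Summation over upper sets, `f ↦ (a ↦ ∑ b ≥ a, f b)`. For `α = Set V` it turns the d-clique
vector into the indicator function of the families (and the empty set). -/
noncomputable def upperSum [Preorder α] [AddCommMonoid M] : (α → M) →+ (α → M) where
  toFun f a := ∑ b with a ≤ b, f b
  map_zero' := by ext; simp
  map_add' f g := by ext; simp [Finset.sum_add_distrib]

theorem upperSum_injective [PartialOrder α] [AddCommGroup M] :
    Function.Injective (upperSum : (α → M) →+ (α → M)) := by
  classical
  refine (injective_iff_map_eq_zero _).2 fun f hf => funext fun a => ?_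
  induction a using WellFoundedGT.induction with
  | ind a ih =>
    calc f a = upperSum f a :=
          (Finset.sum_eq_single_of_mem a (by simp) fun b hb hba =>
            ih b (lt_of_le_of_ne (Finset.mem_filter.1 hb).2 hba.symm)).symm
      _ = 0 := congrFun hf a

end UpperSum

variable [Fintype V]

open Classical in
theorem upperSum_delta (A S : Set V) : upperSum (delta A) S = if S ⊆ A then 1 else 0 := by
  simp [upperSum, delta, Finset.sum_ite_eq']

open Classical in
theorem upperSum_delta_sub_delta (hG : IsAcyclic G) (v : V) (S : Set V) :
    upperSum (delta ({v} ∪ parents G v) - delta (parents G v)) S =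
      if IsFamilyWithHead G S v then 1 else 0 := by
  have hparents : S ⊆ parents G v ↔ v ∉ S ∧ S ⊆ {v} ∪ parents G v := by
    have hirrefl : v ∉ parents G v := hG.irrefl v
    grind
  rw [map_sub, Pi.sub_apply, upperSum_delta, upperSum_delta]
  split_ifs <;> grind [IsFamilyWithHead]

open Classical in
theorem sum_ite_isFamilyWithHead (hG : IsAcyclic G) (S : Set V) :
    (∑ v, if IsFamilyWithHead G S v then 1 else 0 : ℤ) = if IsFamily G S then 1 else 0 := by
  split_ifs with hS
  · obtain ⟨v, hv⟩ := hS
    rw [Fintype.sum_eq_single v fun u huv => if_neg fun hu => huv (hu.head_unique hG hv), if_pos hv]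
  · exact Finset.sum_eq_zero fun v _ => if_neg fun hv => hS ⟨v, hv⟩

open Classical in
theorem upperSum_dCliqueVector (hG : IsAcyclic G) (S : Set V) :
    upperSum (dCliqueVector G) S = (if IsFamily G S then 1 else 0) + if S = ∅ then 1 else 0 := by
  rw [dCliqueVector, map_add, map_sum, Pi.add_apply, Finset.sum_apply, upperSum_delta,
    Finset.sum_congr rfl fun v _ => upperSum_delta_sub_delta hG v S, sum_ite_isFamilyWithHead hG]
  simp only [Set.subset_empty_iff]

theorem dCliqueVector_eq_iff_isFamily_eq (hG : IsAcyclic G) (hG' : IsAcyclic G') :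
    dCliqueVector G = dCliqueVector G' ↔ IsFamily G = IsFamily G' := by
  rw [← upperSum_injective.eq_iff, funext_iff, funext_iff]
  refine forall_congr' fun S => ?_
  rw [upperSum_dCliqueVector hG, upperSum_dCliqueVector hG', add_left_inj]
  by_cases hS : IsFamily G S <;> by_cases hS' : IsFamily G' S <;> simp [hS, hS']

end DagMarkov

theorem mainTheorem3 {V : Type*} [Fintype V] (G G' : Digraph V)
    (hG : DagMarkov.IsAcyclic G) (hG' : DagMarkov.IsAcyclic G') :
    DagMarkov.MarkovEquiv G G' ↔
      DagMarkov.dCliqueVector G = DagMarkov.dCliqueVector G' := by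
  rw [DagMarkov.markovEquiv_iff_isFamily_eq hG hG',
    DagMarkov.dCliqueVector_eq_iff_isFamily_eq hG hG']
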